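/- **Setting.** A *layered circuit* of depth $L$ on $n$ qubits is $$U(\boldsymbol\theta)=\prod_{\ell=1}^{L}\Big(V_\ell\prod_{j=1}^{m_\ell}e^{-i\theta_{\ell,j}G_{\ell,j}}\Big)$$ with fixed unitaries $V_\ell$ on $(\mathbb C^2)^{\otimes n}$, Hermitian generators $G_{\ell,j}$ and independent parameters $\boldsymbol\theta\in\mathbb R^M$, $M=\sum_\ell m_\ell$; $|\psi(\boldsymbol\theta)\rangle=U(\boldsymbol\theta)|0\rangle^{\otimes n}$. The support $\mathrm{supp}(A)$ of an operator $A$ is the set of qubits on which $A$ acts non-trivially. Let $\rho$ be the law under which the parameters are i.i.d. uniform on $[0,2\pi)$, and for a cost $C(\boldsymbol\theta)$ let $H_{ab}=\partial^2C/\partial\theta_a\partial\theta_b$. Consider a family of such circuits with $n\to\infty$ such that, for a fixed $r\in\mathbb N$, every generator satisfies $|\mathrm{supp}(G_{\ell,j})|\le r$ and $G_{\ell,j}^2=\frac14 I$ (spectrum $\{\pm\frac12\}$), and $rL=o(n)$, where $L=L(n)$ is the depth. **Theorem.** For every circuit of the family and all parameter indices $a,b$ the following hold. (i) *Global objectives.*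 Let $C(\boldsymbol\theta)=\langle\psi(\boldsymbol\theta)|O|\psi(\boldsymbol\theta)\rangle$ with $O=O_n$ Hermitian, $\|O\|\le1$, and $|\mathrm{supp}(O)|$ growing linearly with $n$. If $\mathrm{Var}_\rho[C]\le c_{\rm g}(r,L)\,e^{-\alpha(r,L)n}$ with $c_{\rm g},\alpha>0$ not depending on $n$ otherwise than through $L$, then $$\mathrm{Var}_\rho(H_{ab})\le\tilde c(r,L)\,e^{-\tilde\alpha(r,L)n},$$ where the positive functions $\tilde c,\tilde\alpha$ of $(r,L)$ depend only on the functions $c_{\rm g},\alpha$. (ii) *Local objectives.* Let $G=G_n$ be a graph on the $n$ qubits that is an interaction graph of the circuit, meaning: (a) for every $\ell$ and every qubit $q$, an operator $A$ acting only on $q$ is mapped to an operator $V_\ell^\dagger AV_\ell$ acting only on $q$ and its neighbours in $G$; (b) in each layer every generator acts inside an assigned block of qubits whose pairwise distances in $G$ are less than $r$ (for example a connected set of at most $r$ qubits), and generators of the same layer that are assigned different blocks commute. Let $$C(\boldsymbol\theta)=\frac1n\sum_{v=1}^n\langle\psi(\boldsymbol\theta)|O_v|\psi(\boldsymbol\theta)\rangle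 ,$$ where each $O_v$ is Hermitian with $\|O_v\|\le1$ and acts on at most $k$ qubits, all within distance $k$ of the qubit $v$ in $G$. With $V_G(m)=\max_v|B_G(v,m)|$, the maximal number of vertices in a ball of radius $m$, there is a positive function $c_{\rm loc}$ of $(k,r,L)$ alone, not depending on the family, such that $$\mathrm{Var}_\rho(H_{ab})\le c_{\rm loc}(k,r,L)\,\frac{V_G(k+2rL)}{n}.$$ In particular, if $V_G(m)\le K m^D$ for all $m\ge1$ and all graphs of the family, with fixed $K>0$ and $D\in\mathbb R$, then $$\mathrm{Var}_\rho(H_{ab})\le c_{\rm loc}'(k,r,L)\,\frac{(k+2rL)^D}{n},$$ where the positive function $c_{\rm loc}'$ depends only on $D$ and $K$. -/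

import Mathlib

open MeasureTheory Filter
open scoped Matrix

noncomputable section

namespace PQC

/-! ### Qubits, operators and supports -/

/-- Labels of the computational basis of the `n`-qubit space `(ℂ²)^{⊗n}`. -/
abbrev Bits (n : ℕ) : Type := Fin n → Fin 2

/-- Operators on the `n`-qubit space, as matrices in the computational basis. -/
abbrev Op (n : ℕ) : Type := Matrix (Bits n) (Bits n) ℂ

/-- `A` acts as the identity on qubit `q`: `A = I_q ⊗ A'`, written out on matrix entries. -/
def ActsTriviallyAt {n : ℕ} (A : Op n) (q : Fin n) : Prop :=
  (∀ x y : Bits n, x q ≠ y q → A x y = 0) ∧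
  (∀ (x y : Bits n) (b : Fin 2), x q = y q →
    A (Function.update x q b) (Function.update y q b) = A x y)

open Classical in
/-- The support of an operator: the qubits on which it acts non-trivially. -/
def supp {n : ℕ} (A : Op n) : Finset (Fin n) :=
  Finset.univ.filter fun q => ¬ ActsTriviallyAt A q

/-- The operator norm on the `n`-qubit Hilbert space. -/
def opNorm {n : ℕ} (A : Op n) : ℝ := ‖Matrix.toEuclideanCLM (𝕜 := ℂ) A‖

/-- A normalized observable: Hermitian of operator norm at most one. -/
structure IsNormalizedObservable {n : ℕ} (O : Op n) : Prop where
  hermitian : O.IsHermitian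
  norm_le : opNorm O ≤ 1

/-! ### Layered parameterized circuits -/

/-- A layered circuit on `n` qubits: layer `ℓ` consists of a fixed entangling unitary `ent ℓ` and
of `gates ℓ` rotations with generators `gen ℓ j`, each with its own parameter. -/
structure Circuit (n : ℕ) where
  depth : ℕ
  gates : Fin depth → ℕ
  ent : Fin depth → Matrix.unitaryGroup (Bits n) ℂ
  gen : (ℓ : Fin depth) → Fin (gates ℓ) → Op n

namespace Circuit

variable {n : ℕ} (c : Circuit n)

/-- The index set of the parameters. -/
abbrev Idx : Type := (ℓ : Fin c.depth) × Fin (c.gates ℓ)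

/-- Layer `ℓ`: the operator `V_ℓ ∏_j exp(-i θ_{ℓ,j} G_{ℓ,j})`. -/
def layer (θ : c.Idx → ℝ) (ℓ : Fin c.depth) : Op n :=
  (c.ent ℓ : Op n) *
    (List.ofFn fun j : Fin (c.gates ℓ) =>
      NormedSpace.exp ((-Complex.I * (θ ⟨ℓ, j⟩ : ℂ)) • c.gen ℓ j)).prod

/-- The circuit unitary `U(θ) = ∏_ℓ V_ℓ ∏_j exp(-i θ_{ℓ,j} G_{ℓ,j})`. -/
def unitary (θ : c.Idx → ℝ) : Op n := (List.ofFn (c.layer θ)).prod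

/-- The state `|ψ(θ)⟩ = U(θ)|0…0⟩`. -/
def state (θ : c.Idx → ℝ) : Bits n → ℂ := c.unitary θ *ᵥ Pi.single 0 1

/-- The cost `C(θ) = ⟨ψ(θ)| O |ψ(θ)⟩` (real, as `O` is Hermitian). -/
def cost (O : Op n) (θ : c.Idx → ℝ) : ℝ :=
  (star (c.state θ) ⬝ᵥ (O *ᵥ c.state θ)).re

/-- The averaged cost `(1/n) ∑_v ⟨ψ(θ)| O_v |ψ(θ)⟩`. -/
def averagedCost (O : Fin n → Op n) (θ : c.Idx → ℝ) : ℝ :=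
  (1 / (n : ℝ)) * ∑ v, c.cost (O v) θ

/-- Initialization: the parameters are i.i.d. uniform on `[0, 2π)`. -/
def initLaw : Measure (c.Idx → ℝ) :=
  Measure.pi fun _ => ProbabilityTheory.cond volume (Set.Ico 0 (2 * Real.pi))

/-- Two-point-spectrum generators: each generator is Hermitian, is supported on at most `r` qubits
and has eigenvalues `±1/2`, i.e. squares to `I/4`. -/
def HasTwoPointGenerators (r : ℕ) : Prop :=
  ∀ ℓ j, (c.gen ℓ j).IsHermitian ∧ (supp (c.gen ℓ j)).card ≤ r ∧
    c.gen ℓ j * c.gen ℓ j = (1 / 4 : ℂ) • (1 : Op n)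

/-- `G` is an interaction graph of the layered architecture, with gate locality `r`.

* An entangling layer makes a qubit interact only with its neighbours: in the Heisenberg picture an
  operator on qubit `q` becomes an operator on `q` and its neighbours.
* The rotations of a layer form one round of `r`-local gates: each acts inside a block of qubits of
  diameter less than `r` (such as a connected set of at most `r` qubits), and those acting in
  different blocks commute (as they do if the blocks are disjoint). -/
structure IsInteractionGraph (G : SimpleGraph (Fin n)) (r : ℕ) : Prop where
  entangler : ∀ (ℓ : Fin c.depth) (q : Fin n) (A : Op n), supp A ⊆ {q} →
    ∀ p ∈ supp ((c.ent ℓ : Op n)ᴴ * A * (c.ent ℓ : Op n)), p = q ∨ G.Adj q p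
  rotations : ∀ ℓ : Fin c.depth, ∃ block : Fin (c.gates ℓ) → Finset (Fin n),
    (∀ j, supp (c.gen ℓ j) ⊆ block j) ∧
    (∀ j, ∀ p ∈ block j, ∀ q ∈ block j, G.edist p q < r) ∧
    (∀ i j, block i ≠ block j → Commute (c.gen ℓ i) (c.gen ℓ j))

end Circuit

/-- The Hessian entry `∂²f/∂θ_a∂θ_b`. -/
def hessianEntry {ι : Type} [DecidableEq ι] (f : (ι → ℝ) → ℝ) (a b : ι) (θ : ι → ℝ) : ℝ :=
  lineDeriv ℝ (fun θ' => lineDeriv ℝ f θ' (Pi.single b 1)) θ (Pi.single a 1)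

/-! ### Balls and growth of a graph -/

open Classical in
/-- The ball `B_G(v, m)`. -/
def ball {n : ℕ} (G : SimpleGraph (Fin n)) (v : Fin n) (m : ℕ) : Finset (Fin n) :=
  Finset.univ.filter fun w => G.edist v w ≤ m

/-- The growth function `V_G(m) = max_v |B_G(v, m)|`. -/
def growth {n : ℕ} (G : SimpleGraph (Fin n)) (m : ℕ) : ℕ :=
  Finset.univ.sup fun v => (ball G v m).card

/-- `k`-local terms attached to the vertices of `G`: `O v` is a normalized observable that acts on
at most `k` qubits, all of them within distance `k` of `v`. -/
structure IsLocalTerms {n : ℕ} (G : SimpleGraph (Fin n)) (k : ℕ) (O : Fin n → Op n) : Prop where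
  normalized : ∀ v, IsNormalizedObservable (O v)
  card_le : ∀ v, (supp (O v)).card ≤ k
  near : ∀ v, supp (O v) ⊆ ball G v k

/-! ### Families of circuits -/

/-- A family of circuits on `n i → ∞` qubits with two-point-spectrum generators on at most `r`
qubits and depth `L i` such that `r L i = o(n i)`. -/
structure IsAdmissibleFamily (r : ℕ) (n : ℕ → ℕ) (c : (i : ℕ) → Circuit (n i)) : Prop where
  pos : ∀ i, 0 < n i
  tendsto : Tendsto n atTop atTop
  generators : ∀ i, (c i).HasTwoPointGenerators r
  depth : (fun i => (r : ℝ) * ((c i).depth : ℝ)) =o[atTop] fun i => (n i : ℝ)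

/-- The supports of the observables grow linearly with the number of qubits. -/
def IsGlobalFamily (n : ℕ → ℕ) (O : (i : ℕ) → Op (n i)) : Prop :=
  ∃ a : ℝ, 0 < a ∧ ∀ᶠ i in atTop, a * (n i : ℝ) ≤ ((supp (O i)).card : ℝ)

end PQC

end

/-!
Since `G² = I/4`, the gate `exp(-i θ G)` is `cos (θ/2) I - 2 i sin (θ/2) G`, so the cost is a
trigonometric polynomial of degree at most one in each angle. By the parameter-shift rule its
derivative in one angle is half the difference of the cost shifted by `π/2` and by `-π/2` in that
angle. Shifts preserve the uniform law, hence differentiation does not increase the variance, and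
neither does passing to the Hessian.

For local costs, the Heisenberg evolution of `O_v` involves the parameters of its backward light
cone only, and the light cones of `O_v` and `O_w` are disjoint, so that the two costs are
independent, unless the supports of `O_v` and `O_w` are within distance `2 r L`. Thus each of the
`n` terms is correlated with at most `k V_G(k + 2 r L)` terms, and the average of the `n` terms has
variance at most `k V_G(k + 2 r L) / n`.
-/

noncomputable section

open ProbabilityTheory

namespace PQC

/-! ### Supports and commutation -/

section Supports

variable {n : ℕ} {A B : Op n} {q : Fin n}

lemma mem_supp : q ∈ supp A ↔ ¬ ActsTriviallyAt A q := by
  simp [supp]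

lemma notMem_supp : q ∉ supp A ↔ ActsTriviallyAt A q := by
  simp [supp]

lemma apply_piecewise_of_actsTriviallyAt {T : Finset (Fin n)} (h : ∀ q ∈ T, ActsTriviallyAt A q)
    {x y : Bits n} (z : Bits n) (hxy : ∀ q ∈ T, x q = y q) :
    A (T.piecewise z x) (T.piecewise z y) = A x y := by
  induction T using Finset.induction_on with
  | empty => simp
  | insert p T hp ih =>
    rw [Finset.piecewise_insert, Finset.piecewise_insert, (h p (by simp)).2]
    · exact ih (fun q hq => h q (by simp [hq])) (fun q hq => hxy q (by simp [hq]))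
    · simp [hp, hxy p]

lemma mul_apply_of_actsTriviallyAt {T : Finset (Fin n)} (hA : ∀ q ∈ T, ActsTriviallyAt A q)
    (hB : ∀ q ∉ T, ActsTriviallyAt B q) (x y : Bits n) :
    (A * B) x y = A x (T.piecewise x y) * B (T.piecewise x y) y := by
  rw [Matrix.mul_apply]
  refine Finset.sum_eq_single_of_mem _ (Finset.mem_univ _) fun z _ hz => ?_
  by_contra hne
  refine hz (funext fun q => ?_)
  by_cases hq : q ∈ T
  · rw [Finset.piecewise_eq_of_mem _ _ _ hq]
    by_contra h
    exact left_ne_zero_of_mul hne ((hA q hq).1 x z (Ne.symm h))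
  · rw [Finset.piecewise_eq_of_notMem _ _ _ hq]
    by_contra h
    exact right_ne_zero_of_mul hne ((hB q hq).1 z y h)

lemma commute_of_disjoint_supp (h : Disjoint (supp A) (supp B)) : Commute A B := by
  have hA : ∀ q ∈ supp B, ActsTriviallyAt A q := fun q hq =>
    notMem_supp.1 (Finset.disjoint_right.1 h hq)
  have hB : ∀ q ∈ (supp B)ᶜ, ActsTriviallyAt B q := fun q hq =>
    notMem_supp.1 (Finset.mem_compl.1 hq)
  ext x y
  rw [mul_apply_of_actsTriviallyAt hA fun q => notMem_supp.1,
    mul_apply_of_actsTriviallyAt hB fun q hq => hA q (by simpa using hq), mul_comm]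
  congr 1
  · rw [← apply_piecewise_of_actsTriviallyAt hB x fun q hq => by
      rw [Finset.piecewise_eq_of_notMem _ _ _ (Finset.mem_compl.1 hq)]]
    congr 1
    ext q
    by_cases hq : q ∈ supp B <;> simp [hq]
  · rw [← apply_piecewise_of_actsTriviallyAt hA y fun q hq => by
      rw [Finset.piecewise_eq_of_mem _ _ _ hq], Finset.piecewise_compl]
    congr 1
    ext q
    by_cases hq : q ∈ supp B <;> simp [hq]

open Classical in
/-- The matrix unit `|a⟩⟨b|` on qubit `q`, tensored with the identity on the other qubits; these
operators test whether an operator acts trivially at `q`. -/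
def matrixUnitAt (q : Fin n) (a b : Fin 2) : Op n :=
  fun x y => if x q = a ∧ y = Function.update x q b then 1 else 0

lemma supp_matrixUnitAt_subset (q : Fin n) (a b : Fin 2) : supp (matrixUnitAt q a b) ⊆ {q} := by
  intro p hp
  by_contra hpq
  rw [Finset.mem_singleton] at hpq
  refine mem_supp.1 hp ⟨fun x y hxy => ?_, fun x y c hxy => ?_⟩
  · rw [matrixUnitAt, if_neg]
    rintro ⟨-, rfl⟩
    simp [hpq] at hxy
  · have hiff : Function.update y p c = Function.update (Function.update x p c) q b ↔
        y = Function.update x q b := by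
      rw [Function.update_comm hpq]
      refine ⟨fun h => funext fun i => ?_, fun h => by rw [h]⟩
      by_cases hi : i = p
      · subst hi; simp [hpq, hxy]
      · simpa only [Function.update_of_ne hi] using congrFun h i
    simp only [matrixUnitAt, hiff, Function.update_of_ne (Ne.symm hpq)]

lemma matrixUnitAt_mul_apply (q : Fin n) (a b : Fin 2) (A : Op n) (x y : Bits n) :
    (matrixUnitAt q a b * A) x y = if x q = a then A (Function.update x q b) y else 0 := by
  rw [Matrix.mul_apply, Finset.sum_eq_single_of_mem (Function.update x q b) (Finset.mem_univ _)]
  · simp [matrixUnitAt]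
  · intro z _ hz; simp [matrixUnitAt, hz]

lemma conjTranspose_matrixUnitAt (q : Fin n) (a b : Fin 2) :
    (matrixUnitAt q a b)ᴴ = matrixUnitAt q b a := by
  ext x y
  simp only [Matrix.conjTranspose_apply, matrixUnitAt, Function.eq_update_iff]
  rw [apply_ite star, star_one, star_zero]
  congr 1
  grind

lemma mul_matrixUnitAt_apply (q : Fin n) (a b : Fin 2) (A : Op n) (x y : Bits n) :
    (A * matrixUnitAt q a b) x y = if y q = b then A x (Function.update y q a) else 0 := by
  rw [← star_star ((A * matrixUnitAt q a b) x y), ← Matrix.conjTranspose_apply,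
    Matrix.conjTranspose_mul, conjTranspose_matrixUnitAt, matrixUnitAt_mul_apply]
  split_ifs <;> simp

lemma actsTriviallyAt_iff_commute :
    ActsTriviallyAt A q ↔ ∀ B : Op n, supp B ⊆ {q} → Commute A B := by
  refine ⟨fun h B hB => commute_of_disjoint_supp ?_, fun h => ?_⟩
  · exact (Finset.disjoint_singleton_right.2 (notMem_supp.2 h)).mono_right hB
  · have hunit : ∀ (x y : Bits n) (a b : Fin 2),
        (if x q = a then A (Function.update x q b) y else 0) =
          if y q = b then A x (Function.update y q a) else 0 := fun x y a b => by
      rw [← matrixUnitAt_mul_apply, ← mul_matrixUnitAt_apply,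
        (h _ (supp_matrixUnitAt_subset q a b)).eq]
    refine ⟨fun x y hxy => ?_, fun x y b hxy => ?_⟩
    · simpa [hxy.symm] using hunit x y (x q) (x q)
    · simpa [hxy] using hunit x (Function.update y q b) (x q) b

lemma ActsTriviallyAt.mul (hA : ActsTriviallyAt A q) (hB : ActsTriviallyAt B q) :
    ActsTriviallyAt (A * B) q :=
  actsTriviallyAt_iff_commute.2 fun C hC =>
    (actsTriviallyAt_iff_commute.1 hA C hC).mul_left (actsTriviallyAt_iff_commute.1 hB C hC)

lemma ActsTriviallyAt.list_prod {l : List (Op n)} (h : ∀ A ∈ l, ActsTriviallyAt A q) :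
    ActsTriviallyAt l.prod q :=
  actsTriviallyAt_iff_commute.2 fun C hC =>
    Commute.list_prod_left _ _ fun A hA => actsTriviallyAt_iff_commute.1 (h A hA) C hC

lemma ActsTriviallyAt.conjTranspose (hA : ActsTriviallyAt A q) : ActsTriviallyAt Aᴴ q :=
  ⟨fun x y h => by simp [Matrix.conjTranspose_apply, hA.1 y x h.symm],
    fun x y b h => by simp [Matrix.conjTranspose_apply, hA.2 y x b h.symm]⟩

lemma conj_commute_iff {V : Op n} (hV : V ∈ Matrix.unitaryGroup (Bits n) ℂ) :
    Commute (Vᴴ * A * V) B ↔ Commute A (V * B * Vᴴ) := by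
  let e := Unitary.conjStarAlgAut ℂ (Op n) ⟨V, hV⟩
  have hA : e (Vᴴ * A * V) = A := e.apply_symm_apply A
  rw [← commute_map_iff (EquivLike.injective e), hA]
  rfl

/-- The commutant turns the hypothesis, which concerns single qubits, into a statement on arbitrary
supports: if `q ∉ N (supp A)` then `V B V†` is disjoint from `supp A` for each `B` on `q`. -/
lemma exists_mem_supp_of_mem_supp_conj {V : Op n} (hV : V ∈ Matrix.unitaryGroup (Bits n) ℂ)
    {N : Fin n → Fin n → Prop}
    (h : ∀ (q : Fin n) (A : Op n), supp A ⊆ {q} → ∀ p ∈ supp (Vᴴ * A * V), N q p)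
    (A : Op n) {p : Fin n} (hp : p ∈ supp (Vᴴ * A * V)) : ∃ q ∈ supp A, N q p := by
  by_contra! hcon
  refine mem_supp.1 hp (actsTriviallyAt_iff_commute.2 fun B hB => ?_)
  have hconj : ∀ q ∈ supp A, ActsTriviallyAt (V * B * Vᴴ) q := fun q hq =>
    actsTriviallyAt_iff_commute.2 fun C hC => Commute.symm <| (conj_commute_iff hV).1 <|
      commute_of_disjoint_supp <| Disjoint.mono_right hB <|
        Finset.disjoint_singleton_right.2 fun hpC => hcon q hq (h q C hC p hpC)
  exact (conj_commute_iff hV).2 <|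
    commute_of_disjoint_supp (Finset.disjoint_left.2 fun q hq => notMem_supp.2 (hconj q hq))

end Supports

/-! ### Rotation gates -/

/-- The rotation `exp(-i t G)` generated by `G`. -/
def gate {n : ℕ} (G : Op n) (t : ℝ) : Op n := NormedSpace.exp ((-Complex.I * (t : ℂ)) • G)

lemma exp_smul_of_mul_self_eq_one {𝔸 : Type*} [NormedRing 𝔸] [NormedAlgebra ℂ 𝔸] [CompleteSpace 𝔸]
    {X : 𝔸} (hX : X * X = 1) (z : ℂ) :
    NormedSpace.exp (z • X) = Complex.cosh z • (1 : 𝔸) + Complex.sinh z • X := by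
  have heven : ∀ m : ℕ, X ^ (2 * m) = 1 := fun m => by rw [pow_mul, pow_two, hX, one_pow]
  refine (NormedSpace.exp_series_hasSum_exp' (𝕂 := ℂ) (z • X)).unique (HasSum.even_add_odd ?_ ?_)
  · refine ((Complex.hasSum_cosh z).smul_const (1 : 𝔸)).congr_fun fun m => ?_
    rw [smul_pow, heven, smul_smul, div_eq_inv_mul]
  · refine ((Complex.hasSum_sinh z).smul_const X).congr_fun fun m => ?_
    rw [smul_pow, pow_succ X, heven, one_mul, smul_smul, div_eq_inv_mul]

section Gate

variable {n : ℕ} {G G' : Op n}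

attribute [local instance] Matrix.linftyOpNormedRing Matrix.linftyOpNormedAlgebra

lemma gate_eq (hG : G * G = (1 / 4 : ℂ) • (1 : Op n)) (t : ℝ) :
    gate G t = ((Real.cos (t / 2) : ℝ) : ℂ) • (1 : Op n) +
      ((Real.sin (t / 2) : ℝ) : ℂ) • ((-2 * Complex.I) • G) := by
  have hX : ((2 : ℂ) • G) * ((2 : ℂ) • G) = 1 := by
    rw [smul_mul_smul_comm, hG, smul_smul]; norm_num
  have harg : (-Complex.I * (t : ℂ)) • G = ((-(t / 2 : ℂ)) * Complex.I) • ((2 : ℂ) • G) := by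
    rw [smul_smul]; congr 1; ring
  rw [gate, harg]
  refine (exp_smul_of_mul_self_eq_one hX _).trans ?_
  rw [Complex.cosh_mul_I, Complex.sinh_mul_I, Complex.cos_neg, Complex.sin_neg]
  push_cast
  module

lemma continuous_gate (G : Op n) : Continuous (gate G) := by
  let _ : NormedAlgebra ℚ (Op n) := NormedAlgebra.restrictScalars ℚ ℂ (Op n)
  exact NormedSpace.exp_continuous.comp (by fun_prop)

lemma gate_mem_unitaryGroup (hG : G.IsHermitian) (t : ℝ) :
    gate G t ∈ Matrix.unitaryGroup (Bits n) ℂ := by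
  have hstar : (gate G t)ᴴ = NormedSpace.exp (-((-Complex.I * (t : ℂ)) • G)) := by
    rw [gate, ← Matrix.exp_conjTranspose, Matrix.conjTranspose_smul, hG.eq, ← neg_smul]
    simp
  rw [Matrix.mem_unitaryGroup_iff, Matrix.star_eq_conjTranspose, hstar, gate,
    ← Matrix.exp_add_of_commute _ _ (Commute.refl ((-Complex.I * (t : ℂ)) • G)).neg_right,
    add_neg_cancel, NormedSpace.exp_zero]

lemma commute_gate (h : Commute G G') (t t' : ℝ) : Commute (gate G t) (gate G' t') := by
  let _ : NormedAlgebra ℚ (Op n) := NormedAlgebra.restrictScalars ℚ ℂ (Op n)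
  exact ((h.smul_left _).smul_right _).exp

lemma ActsTriviallyAt.gate {q : Fin n} (hG : ActsTriviallyAt G q) (t : ℝ) :
    ActsTriviallyAt (gate G t) q := by
  let _ : NormedAlgebra ℚ (Op n) := NormedAlgebra.restrictScalars ℚ ℂ (Op n)
  exact actsTriviallyAt_iff_commute.2 fun B hB =>
    ((actsTriviallyAt_iff_commute.1 hG B hB).smul_left _).exp_left

end Gate

/-! ### Dependence of the cost on a single parameter -/

lemma prod_ofFn_update {M : Type*} [Monoid M] {m : ℕ} (f : Fin m → M) (j : Fin m) (x : M) :
    (List.ofFn (Function.update f j x)).prod =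
      ((List.ofFn f).take j).prod * x * ((List.ofFn f).drop (j + 1)).prod := by
  have hset : List.ofFn (Function.update f j x) = (List.ofFn f).set j x :=
    List.ext_getElem (by simp) fun i hi _ => by
      rw [List.getElem_set]
      simp [Function.update_apply, Fin.ext_iff, eq_comm]
  rw [hset, List.prod_set, if_pos (by simp)]

/-- `f` is a trigonometric polynomial of degree at most one in each of its variables. -/
def IsMultiTrig {ι : Type} [DecidableEq ι] (f : (ι → ℝ) → ℝ) : Prop :=
  ∀ θ a, ∃ α β γ : ℝ, ∀ s : ℝ, f (Function.update θ a s) = α + β * Real.cos s + γ * Real.sin s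

lemma exists_re_quadraticForm_eq {n : ℕ} (O : Op n) (u w : Bits n → ℂ) :
    ∃ α β γ : ℝ, ∀ s : ℝ, ∀ ψ : Bits n → ℂ,
      ψ = ((Real.cos (s / 2) : ℝ) : ℂ) • u + ((Real.sin (s / 2) : ℝ) : ℂ) • w →
      (star ψ ⬝ᵥ (O *ᵥ ψ)).re = α + β * Real.cos s + γ * Real.sin s := by
  set p := (star u ⬝ᵥ (O *ᵥ u)).re
  set q := (star u ⬝ᵥ (O *ᵥ w)).re + (star w ⬝ᵥ (O *ᵥ u)).re
  set t := (star w ⬝ᵥ (O *ᵥ w)).re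
  refine ⟨(p + t) / 2, (p - t) / 2, q / 2, fun s ψ hψ => ?_⟩
  have hcos : Real.cos s = Real.cos (s / 2) ^ 2 - Real.sin (s / 2) ^ 2 := by
    rw [← Real.cos_two_mul', mul_div_cancel₀ s two_ne_zero]
  have hsin : Real.sin s = 2 * Real.sin (s / 2) * Real.cos (s / 2) := by
    rw [← Real.sin_two_mul, mul_div_cancel₀ s two_ne_zero]
  have hexpand : (star ψ ⬝ᵥ (O *ᵥ ψ)).re = Real.cos (s / 2) ^ 2 * p +
      Real.cos (s / 2) * Real.sin (s / 2) * q + Real.sin (s / 2) ^ 2 * t := by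
    rw [hψ]
    simp only [star_add, star_smul, Matrix.mulVec_add, Matrix.mulVec_smul, add_dotProduct,
      dotProduct_add, smul_dotProduct, dotProduct_smul, Complex.star_def, Complex.conj_ofReal,
      smul_eq_mul, Complex.add_re, Complex.re_ofReal_mul]
    ring
  rw [hexpand, hcos, hsin]
  linear_combination ((p + t) / 2) * Real.cos_sq_add_sin_sq (s / 2)

namespace Circuit

variable {n : ℕ} (c : Circuit n)

lemma layer_eq (θ : c.Idx → ℝ) (ℓ : Fin c.depth) :
    c.layer θ ℓ = (c.ent ℓ : Op n) *
      (List.ofFn fun j : Fin (c.gates ℓ) => gate (c.gen ℓ j) (θ ⟨ℓ, j⟩)).prod := rfl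

lemma layer_update_of_ne (θ : c.Idx → ℝ) {ℓ ℓ' : Fin c.depth} (h : ℓ' ≠ ℓ)
    (j : Fin (c.gates ℓ)) (s : ℝ) :
    c.layer (Function.update θ ⟨ℓ, j⟩ s) ℓ' = c.layer θ ℓ' := by
  rw [layer_eq, layer_eq]
  congr 3
  funext i
  rw [Function.update_of_ne fun hi => h (congrArg Sigma.fst hi)]

lemma exists_layer_update (θ : c.Idx → ℝ) (ℓ : Fin c.depth) (j : Fin (c.gates ℓ)) :
    ∃ A B : Op n, ∀ s : ℝ,
      c.layer (Function.update θ ⟨ℓ, j⟩ s) ℓ = A * gate (c.gen ℓ j) s * B := by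
  let gates := fun i => gate (c.gen ℓ i) (θ ⟨ℓ, i⟩)
  have hgates : ∀ s : ℝ,
      (fun i => gate (c.gen ℓ i) (Function.update θ ⟨ℓ, j⟩ s ⟨ℓ, i⟩)) =
        Function.update gates j (gate (c.gen ℓ j) s) :=
    fun s => funext fun i => by
      rw [← Function.apply_update (fun i => gate (c.gen ℓ i)) (fun i => θ ⟨ℓ, i⟩)]
      exact congrArg _ (congrFun
        (Function.update_comp_eq_of_injective θ sigma_mk_injective j s) i)
  refine ⟨c.ent ℓ * ((List.ofFn gates).take j).prod, ((List.ofFn gates).drop (j + 1)).prod,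
    fun s => ?_⟩
  rw [layer_eq, hgates, prod_ofFn_update, ← mul_assoc, ← mul_assoc]

lemma exists_unitary_update (θ : c.Idx → ℝ) (a : c.Idx) :
    ∃ A B : Op n, ∀ s : ℝ,
      c.unitary (Function.update θ a s) = A * gate (c.gen a.1 a.2) s * B := by
  obtain ⟨A, B, hAB⟩ := c.exists_layer_update θ a.1 a.2
  have hlayer : ∀ s : ℝ, c.layer (Function.update θ a s) =
      Function.update (c.layer θ) a.1 (A * gate (c.gen a.1 a.2) s * B) := fun s =>
    Function.eq_update_iff.2 ⟨hAB s, fun ℓ hℓ => c.layer_update_of_ne θ hℓ a.2 s⟩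
  refine ⟨((List.ofFn (c.layer θ)).take a.1).prod * A,
    B * ((List.ofFn (c.layer θ)).drop (a.1 + 1)).prod, fun s => ?_⟩
  rw [unitary, hlayer, prod_ofFn_update]
  simp only [mul_assoc]

variable {c}

lemma isMultiTrig_cost (hsq : ∀ ℓ j, c.gen ℓ j * c.gen ℓ j = (1 / 4 : ℂ) • (1 : Op n))
    (O : Op n) : IsMultiTrig (c.cost O) := by
  intro θ a
  obtain ⟨A, B, hAB⟩ := c.exists_unitary_update θ a
  obtain ⟨α, β, γ, h⟩ := exists_re_quadraticForm_eq O ((A * B) *ᵥ Pi.single 0 1)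
    ((A * ((-2 * Complex.I) • c.gen a.1 a.2) * B) *ᵥ Pi.single 0 1)
  refine ⟨α, β, γ, fun s => h s _ ?_⟩
  rw [state, hAB, gate_eq (hsq a.1 a.2), ← Matrix.smul_mulVec, ← Matrix.smul_mulVec,
    ← Matrix.add_mulVec]
  congr 1
  simp only [mul_add, add_mul, mul_smul_comm, smul_mul_assoc, mul_one]

/-! ### Continuity and boundedness of the cost -/

lemma continuous_unitary : Continuous c.unitary := by
  have hlayer : ∀ ℓ, Continuous fun θ => c.layer θ ℓ := fun ℓ => by
    simp only [layer_eq, List.ofFn_eq_map]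
    exact continuous_const.mul (continuous_list_prod _ fun j _ =>
      (continuous_gate (c.gen ℓ j)).comp (continuous_apply _))
  change Continuous fun θ => (List.ofFn (c.layer θ)).prod
  simp only [List.ofFn_eq_map]
  exact continuous_list_prod _ fun ℓ _ => hlayer ℓ

lemma continuous_cost (O : Op n) : Continuous (c.cost O) := by
  have hstate : Continuous c.state := continuous_unitary.matrix_mulVec continuous_const
  exact Complex.continuous_re.comp
    (hstate.star.dotProduct (continuous_const.matrix_mulVec hstate))

lemma unitary_mem_unitaryGroup (hH : ∀ ℓ j, (c.gen ℓ j).IsHermitian) (θ : c.Idx → ℝ) :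
    c.unitary θ ∈ Matrix.unitaryGroup (Bits n) ℂ := by
  refine list_prod_mem fun x hx => ?_
  obtain ⟨ℓ, rfl⟩ := List.mem_ofFn.1 hx
  refine mul_mem (c.ent ℓ).2 (list_prod_mem fun y hy => ?_)
  obtain ⟨j, rfl⟩ := List.mem_ofFn.1 hy
  exact gate_mem_unitaryGroup (hH ℓ j) _

lemma norm_state (hH : ∀ ℓ j, (c.gen ℓ j).IsHermitian) (θ : c.Idx → ℝ) :
    ‖(WithLp.toLp 2 (c.state θ) : EuclideanSpace ℂ (Bits n))‖ = 1 := by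
  have hstar : star (c.state θ) ⬝ᵥ c.state θ = 1 := by
    rw [state, Matrix.star_mulVec, ← Matrix.dotProduct_mulVec, Matrix.mulVec_mulVec,
      ← Matrix.star_eq_conjTranspose,
      Matrix.mem_unitaryGroup_iff'.1 (unitary_mem_unitaryGroup hH θ), Matrix.one_mulVec,
      ← Pi.single_star, star_one, single_one_dotProduct, Pi.single_eq_same]
  rw [← sq_eq_sq₀ (norm_nonneg _) zero_le_one, one_pow, ← inner_self_eq_norm_sq (𝕜 := ℂ),
    EuclideanSpace.inner_eq_star_dotProduct, dotProduct_comm, hstar, RCLike.one_re]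

lemma abs_cost_le_opNorm (hH : ∀ ℓ j, (c.gen ℓ j).IsHermitian) (O : Op n) (θ : c.Idx → ℝ) :
    |c.cost O θ| ≤ opNorm O := by
  set ψ : EuclideanSpace ℂ (Bits n) := WithLp.toLp 2 (c.state θ)
  have hψ : ‖ψ‖ = 1 := norm_state hH θ
  have hinner : star (c.state θ) ⬝ᵥ (O *ᵥ c.state θ) =
      inner ℂ ψ (Matrix.toEuclideanCLM (𝕜 := ℂ) O ψ) := by
    rw [EuclideanSpace.inner_eq_star_dotProduct, dotProduct_comm]
    rfl
  calc |c.cost O θ|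
      ≤ ‖inner ℂ ψ (Matrix.toEuclideanCLM (𝕜 := ℂ) O ψ)‖ := by
        rw [cost, hinner]; exact Complex.abs_re_le_norm _
    _ ≤ ‖ψ‖ * (opNorm O * ‖ψ‖) :=
        (norm_inner_le_norm _ _).trans (by gcongr; exact ContinuousLinearMap.le_opNorm _ _)
    _ = opNorm O := by rw [hψ, one_mul, mul_one]

lemma averagedCost_eq_cost (O : Fin n → Op n) :
    c.averagedCost O = c.cost ((1 / n : ℝ) • ∑ v, O v) := by
  funext θ
  simp only [averagedCost, cost, Matrix.smul_mulVec, Matrix.sum_mulVec, dotProduct_smul,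
    dotProduct_sum, Complex.real_smul, Complex.re_ofReal_mul, Complex.re_sum]

end Circuit

/-! ### Rotation invariance of the uniform law -/

/-- The uniform law on `[0, 2π)`. -/
def uniformAngle : Measure ℝ := cond volume (Set.Ico 0 (2 * Real.pi))

/-- The law of i.i.d. uniform angles indexed by `ι`; `Circuit.initLaw` is the case of the
parameters of a circuit. -/
def uniformAngles (ι : Type) [Fintype ι] : Measure (ι → ℝ) := Measure.pi fun _ => uniformAngle

instance : IsProbabilityMeasure uniformAngle :=
  cond_isProbabilityMeasure_of_finite
    (by simp [Real.volume_Ico, Real.pi_pos]) (by rw [Real.volume_Ico]; exact ENNReal.ofReal_ne_top)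

instance (ι : Type) [Fintype ι] : IsProbabilityMeasure (uniformAngles ι) :=
  inferInstanceAs (IsProbabilityMeasure (Measure.pi _))

/-- Rotation of an angle by `s`, normalized to `[0, 2π)`. -/
def rotateAngle (s x : ℝ) : ℝ := toIcoMod Real.two_pi_pos 0 (x + s)

/-- On the circle `ℝ / 2πℤ` the rotation is a translation, which preserves the Haar measure. -/
lemma measurePreserving_rotateAngle (s : ℝ) :
    MeasurePreserving (rotateAngle s) uniformAngle uniformAngle := by
  let T : ℝ := 2 * Real.pi
  have : Fact (0 < T) := ⟨Real.two_pi_pos⟩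
  let lift : AddCircle T → ℝ := fun u => AddCircle.measurableEquivIco T 0 u
  have hlift : Measurable lift :=
    measurable_subtype_coe.comp (AddCircle.measurableEquivIco T 0).measurable
  have hmk : MeasurePreserving ((↑) : ℝ → AddCircle T) (volume.restrict (Set.Ico 0 T)) volume := by
    simpa only [zero_add, Measure.restrict_congr_set Ico_ae_eq_Ioc] using
      AddCircle.measurePreserving_mk T 0
  have hlift_mk : ∀ x : ℝ, lift x = toIcoMod Real.two_pi_pos 0 x := fun x => rfl
  have hlift_mp : MeasurePreserving lift volume (volume.restrict (Set.Ico 0 T)) := by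
    refine ⟨hlift, ?_⟩
    rw [← hmk.map_eq, Measure.map_map hlift hmk.measurable]
    refine (Measure.map_congr ?_).trans Measure.map_id
    filter_upwards [ae_restrict_mem measurableSet_Ico] with x hx
    rw [Function.comp_apply, hlift_mk, id, toIcoMod_eq_self, zero_add]
    exact hx
  have hrotate : rotateAngle s = lift ∘ (· + (s : AddCircle T)) ∘ (↑) := by
    funext x
    simp only [Function.comp_apply, ← AddCircle.coe_add, hlift_mk, rotateAngle]
  rw [hrotate]
  exact (hlift_mp.comp ((measurePreserving_add_right volume _).comp hmk)).smul_measure _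

/-! ### The parameter-shift rule -/

section

variable {Ω : Type*} [MeasurableSpace Ω] {μ : Measure Ω} [IsFiniteMeasure μ] {X Y : Ω → ℝ}

lemma covariance_le_half_variance_add (hX : MemLp X 2 μ) (hY : MemLp Y 2 μ) :
    cov[X, Y; μ] ≤ (Var[X; μ] + Var[Y; μ]) / 2 := by
  linarith [variance_sub hX hY, variance_nonneg (X - Y) μ]

lemma variance_half_sub_le (hX : MemLp X 2 μ) (hY : MemLp Y 2 μ) :
    Var[fun ω => 2⁻¹ * (X ω - Y ω); μ] ≤ (Var[X; μ] + Var[Y; μ]) / 2 := by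
  rw [variance_const_mul, ← Pi.sub_def X Y]
  linarith [variance_add hX hY, variance_sub hX hY, variance_nonneg (X + Y) μ]

end

/-- Bounded continuous functions that are trigonometric polynomials of degree at most one in each
variable: the class of functions of the angles to which the costs of a circuit and their partial
derivatives belong. -/
structure IsTrigCost {ι : Type} [DecidableEq ι] (f : (ι → ℝ) → ℝ) : Prop where
  continuous : Continuous f
  bounded : ∃ M, ∀ θ, |f θ| ≤ M
  trig : IsMultiTrig f

/-- The function `f` with its variable `a` shifted by `s`. -/
def shiftAt {ι : Type} [DecidableEq ι] (a : ι) (s : ℝ) (f : (ι → ℝ) → ℝ) (θ : ι → ℝ) : ℝ :=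
  f (Function.update θ a (θ a + s))

section

variable {ι : Type} [DecidableEq ι] {f g : (ι → ℝ) → ℝ}

lemma IsTrigCost.memLp [Fintype ι] (hf : IsTrigCost f) : MemLp f 2 (uniformAngles ι) := by
  obtain ⟨M, hM⟩ := hf.bounded
  exact MemLp.of_bound hf.continuous.aestronglyMeasurable M (Eventually.of_forall hM)

lemma IsTrigCost.sub (hf : IsTrigCost f) (hg : IsTrigCost g) : IsTrigCost fun θ => f θ - g θ := by
  refine ⟨hf.continuous.sub hg.continuous, ?_, fun θ a => ?_⟩
  · obtain ⟨M, hM⟩ := hf.bounded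
    obtain ⟨N, hN⟩ := hg.bounded
    exact ⟨M + N, fun θ => (abs_sub _ _).trans (add_le_add (hM θ) (hN θ))⟩
  · obtain ⟨α, β, γ, h⟩ := hf.trig θ a
    obtain ⟨α', β', γ', h'⟩ := hg.trig θ a
    exact ⟨α - α', β - β', γ - γ', fun s => by rw [h, h']; ring⟩

lemma IsTrigCost.const_mul (hf : IsTrigCost f) (k : ℝ) : IsTrigCost fun θ => k * f θ := by
  refine ⟨continuous_const.mul hf.continuous, ?_, fun θ a => ?_⟩
  · obtain ⟨M, hM⟩ := hf.bounded
    exact ⟨|k| * M, fun θ => by rw [abs_mul]; gcongr; exact hM θ⟩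
  · obtain ⟨α, β, γ, h⟩ := hf.trig θ a
    exact ⟨k * α, k * β, k * γ, fun s => by rw [h]; ring⟩

lemma IsMultiTrig.shiftAt (hf : IsMultiTrig f) (a : ι) (s : ℝ) : IsMultiTrig (shiftAt a s f) := by
  intro θ b
  by_cases hab : b = a
  · subst hab
    obtain ⟨α, β, γ, h⟩ := hf θ b
    refine ⟨α, β * Real.cos s + γ * Real.sin s, γ * Real.cos s - β * Real.sin s, fun t => ?_⟩
    rw [PQC.shiftAt, Function.update_self, Function.update_idem, h, Real.cos_add, Real.sin_add]
    ring
  · obtain ⟨α, β, γ, h⟩ := hf (Function.update θ a (θ a + s)) b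
    refine ⟨α, β, γ, fun t => ?_⟩
    rw [PQC.shiftAt, ← h, Function.update_of_ne (Ne.symm hab), Function.update_comm hab]

lemma IsTrigCost.shiftAt (hf : IsTrigCost f) (a : ι) (s : ℝ) : IsTrigCost (shiftAt a s f) where
  continuous := hf.continuous.comp
    (continuous_id.update a ((continuous_apply a).add continuous_const))
  bounded := hf.bounded.imp fun _ hM _ => hM _
  trig := hf.trig.shiftAt a s

lemma IsMultiTrig.shiftAt_eq_update_rotateAngle (hf : IsMultiTrig f) (a : ι) (s : ℝ) (θ : ι → ℝ) :
    PQC.shiftAt a s f θ = f (Function.update θ a (rotateAngle s (θ a))) := by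
  obtain ⟨α, β, γ, h⟩ := hf θ a
  rw [PQC.shiftAt, h, h, rotateAngle, toIcoMod, zsmul_eq_mul, Real.cos_sub_int_mul_two_pi,
    Real.sin_sub_int_mul_two_pi]

lemma measurePreserving_update_rotateAngle [Fintype ι] (a : ι) (s : ℝ) :
    MeasurePreserving (fun θ : ι → ℝ => Function.update θ a (rotateAngle s (θ a)))
      (uniformAngles ι) (uniformAngles ι) := by
  have hpi : (fun θ : ι → ℝ => Function.update θ a (rotateAngle s (θ a))) =
      fun θ i => (Function.update (fun _ => id) a (rotateAngle s) : ι → ℝ → ℝ) i (θ i) := by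
    funext θ i
    by_cases hi : i = a
    · subst hi; simp
    · simp [hi]
  rw [hpi]
  refine measurePreserving_pi _ _ fun i => ?_
  by_cases hi : i = a
  · subst hi
    simpa using measurePreserving_rotateAngle s
  · simpa [hi] using MeasurePreserving.id uniformAngle

lemma IsTrigCost.variance_shiftAt [Fintype ι] (hf : IsTrigCost f) (a : ι) (s : ℝ) :
    Var[PQC.shiftAt a s f; uniformAngles ι] = Var[f; uniformAngles ι] := by
  rw [funext (hf.trig.shiftAt_eq_update_rotateAngle a s)]
  exact (measurePreserving_update_rotateAngle a s).variance_fun_comp hf.continuous.aemeasurable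

lemma IsMultiTrig.lineDeriv_eq (hf : IsMultiTrig f) (a : ι) (θ : ι → ℝ) :
    lineDeriv ℝ f θ (Pi.single a 1) =
      2⁻¹ * (PQC.shiftAt a (Real.pi / 2) f θ - PQC.shiftAt a (-(Real.pi / 2)) f θ) := by
  obtain ⟨α, β, γ, h⟩ := hf θ a
  have hline : (fun t : ℝ => f (θ + t • Pi.single a 1)) =
      fun t => α + β * Real.cos (θ a + t) + γ * Real.sin (θ a + t) := by
    funext t
    rw [← h]
    exact congrArg f (Function.eq_update_iff.2 ⟨by simp, fun i hi => by simp [hi]⟩)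
  have hderiv : HasDerivAt (fun t => α + β * Real.cos (θ a + t) + γ * Real.sin (θ a + t))
      (β * (-Real.sin (θ a + 0) * 1) + γ * (Real.cos (θ a + 0) * 1)) 0 := by
    have hadd : HasDerivAt (fun t : ℝ => θ a + t) 1 0 := (hasDerivAt_id 0).const_add (θ a)
    exact ((hadd.cos.const_mul β).const_add α).add (hadd.sin.const_mul γ)
  rw [lineDeriv, hline, hderiv.deriv, PQC.shiftAt, PQC.shiftAt, h, h, ← sub_eq_add_neg,
    Real.cos_add_pi_div_two, Real.sin_add_pi_div_two, Real.cos_sub_pi_div_two,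
    Real.sin_sub_pi_div_two, add_zero]
  ring

lemma IsTrigCost.lineDeriv (hf : IsTrigCost f) (a : ι) :
    IsTrigCost fun θ => lineDeriv ℝ f θ (Pi.single a 1) := by
  simp only [hf.trig.lineDeriv_eq]
  exact ((hf.shiftAt a _).sub (hf.shiftAt a _)).const_mul _

lemma IsTrigCost.variance_lineDeriv_le [Fintype ι] (hf : IsTrigCost f) (a : ι) :
    Var[fun θ => _root_.lineDeriv ℝ f θ (Pi.single a 1); uniformAngles ι] ≤
      Var[f; uniformAngles ι] := by
  simp only [hf.trig.lineDeriv_eq]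
  refine (variance_half_sub_le (hf.shiftAt a _).memLp (hf.shiftAt a _).memLp).trans_eq ?_
  rw [hf.variance_shiftAt, hf.variance_shiftAt, add_self_div_two]

lemma IsTrigCost.variance_hessianEntry_le [Fintype ι] (hf : IsTrigCost f) (a b : ι) :
    Var[hessianEntry f a b; uniformAngles ι] ≤ Var[f; uniformAngles ι] :=
  ((hf.lineDeriv b).variance_lineDeriv_le a).trans (hf.variance_lineDeriv_le b)

end

namespace Circuit

variable {n : ℕ} {c : Circuit n}

lemma isTrigCost_cost (hH : ∀ ℓ j, (c.gen ℓ j).IsHermitian)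
    (hsq : ∀ ℓ j, c.gen ℓ j * c.gen ℓ j = (1 / 4 : ℂ) • (1 : Op n)) (O : Op n) :
    IsTrigCost (c.cost O) where
  continuous := continuous_cost O
  bounded := ⟨opNorm O, abs_cost_le_opNorm hH O⟩
  trig := isMultiTrig_cost hsq O

lemma memLp_cost (hH : ∀ ℓ j, (c.gen ℓ j).IsHermitian) (O : Op n) :
    MemLp (c.cost O) 2 (uniformAngles c.Idx) :=
  MemLp.of_bound (continuous_cost O).aestronglyMeasurable (opNorm O)
    (Eventually.of_forall (abs_cost_le_opNorm hH O))

lemma variance_cost_le (hH : ∀ ℓ j, (c.gen ℓ j).IsHermitian) (O : Op n) :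
    Var[c.cost O; uniformAngles c.Idx] ≤ opNorm O ^ 2 := by
  refine (variance_le_sq_of_bounded
    (Eventually.of_forall fun θ => abs_le.1 (abs_cost_le_opNorm hH O θ))
    (continuous_cost O).aemeasurable).trans_eq ?_
  ring

end Circuit

/-! ### Independence of functions of disjoint sets of variables -/

lemma comp_updateFinset_comp_restrict {ι γ : Type*} [DecidableEq ι] {Ω : ι → Type*}
    {h : (∀ i, Ω i) → γ} {U : Finset ι} (hU : DependsOn h (U : Set ι)) (x₀ : ∀ i, Ω i) :
    (h ∘ Function.updateFinset x₀ U) ∘ U.restrict = h :=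
  funext fun _ => hU fun i hi => by simp [Function.updateFinset, Finset.mem_coe.1 hi]

lemma indepFun_of_dependsOn {ι : Type*} [Fintype ι] {Ω : ι → Type*} [∀ i, MeasurableSpace (Ω i)]
    {μ : ∀ i, Measure (Ω i)} [∀ i, IsProbabilityMeasure (μ i)]
    {α β : Type*} [MeasurableSpace α] [MeasurableSpace β] {f : (∀ i, Ω i) → α} {g : (∀ i, Ω i) → β}
    (hf : Measurable f) (hg : Measurable g) {S T : Set ι} (hST : Disjoint S T)
    (hfS : DependsOn f S) (hgT : DependsOn g T) : IndepFun f g (Measure.pi μ) := by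
  classical
  have : ∀ i, Nonempty (Ω i) := fun i => nonempty_of_isProbabilityMeasure (μ i)
  let x₀ : ∀ i, Ω i := fun i => Classical.arbitrary (Ω i)
  have hcoord : iIndepFun (fun i (x : ∀ i, Ω i) => x i) (Measure.pi μ) :=
    iIndepFun_pi (X := fun _ => id) fun _ => aemeasurable_id
  have hres : IndepFun S.toFinset.restrict T.toFinset.restrict (Measure.pi μ) :=
    hcoord.indepFun_finset _ _ (Set.disjoint_toFinset.2 hST) measurable_pi_apply
  rw [← comp_updateFinset_comp_restrict (h := f) (U := S.toFinset) (by simpa using hfS) x₀,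
    ← comp_updateFinset_comp_restrict (h := g) (U := T.toFinset) (by simpa using hgT) x₀]
  exact hres.comp (hf.comp measurable_updateFinset) (hg.comp measurable_updateFinset)

/-! ### Light cones -/

lemma prod_map_eq_filter_mul_filter {M κ : Type*} [Monoid M] (f : κ → M) (P : κ → Prop)
    [DecidablePred P] (h : ∀ i j, P i → ¬ P j → Commute (f i) (f j)) (l : List κ) :
    (l.map f).prod =
      ((l.filter fun i => ¬ P i).map f).prod * ((l.filter fun i => P i).map f).prod := by
  induction l with
  | nil => simp
  | cons i l ih =>
    by_cases hi : P i
    · have hcomm : Commute (f i) ((l.filter fun i => ¬ P i).map f).prod := by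
        refine Commute.list_prod_right _ _ fun x hx => ?_
        obtain ⟨j, hj, rfl⟩ := List.mem_map.1 hx
        exact h i j hi (by simpa using (List.mem_filter.1 hj).2)
      rw [List.map_cons, List.prod_cons, ih, List.filter_cons_of_neg (by simpa using hi),
        List.filter_cons_of_pos (by simpa using hi), List.map_cons, List.prod_cons, ← mul_assoc,
        hcomm.eq, mul_assoc]
    · rw [List.map_cons, List.prod_cons, ih, List.filter_cons_of_pos (by simpa using hi),
        List.filter_cons_of_neg (by simpa using hi), List.map_cons, List.prod_cons, mul_assoc]

lemma conj_eq_self_of_commute {n : ℕ} {A W : Op n} (hW : W ∈ Matrix.unitaryGroup (Bits n) ℂ)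
    (h : Commute W A) : Wᴴ * A * W = A := by
  rw [mul_assoc, ← h.eq, ← mul_assoc, ← Matrix.star_eq_conjTranspose,
    Matrix.mem_unitaryGroup_iff'.1 hW, one_mul]

namespace Circuit

variable {n : ℕ} {c : Circuit n} {G : SimpleGraph (Fin n)} {r : ℕ}

section Rotations

variable {ℓ : Fin c.depth} {J : Set (Fin (c.gates ℓ))}

open Classical in
/-- The product of the rotations of layer `ℓ` with index in `J`. -/
def rotationsIn (c : Circuit n) (ℓ : Fin c.depth) (J : Set (Fin (c.gates ℓ))) (θ : c.Idx → ℝ) :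
    Op n :=
  (((List.finRange (c.gates ℓ)).filter fun j => j ∈ J).map
    fun j => gate (c.gen ℓ j) (θ ⟨ℓ, j⟩)).prod

lemma rotationsIn_congr {θ θ' : c.Idx → ℝ} (h : ∀ j ∈ J, θ ⟨ℓ, j⟩ = θ' ⟨ℓ, j⟩) :
    c.rotationsIn ℓ J θ = c.rotationsIn ℓ J θ' := by
  refine congrArg List.prod (List.map_congr_left fun j hj => ?_)
  rw [h j (by simpa using (List.mem_filter.1 hj).2)]

lemma rotationsIn_mem_unitaryGroup (hH : ∀ ℓ j, (c.gen ℓ j).IsHermitian) (θ : c.Idx → ℝ) :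
    c.rotationsIn ℓ J θ ∈ Matrix.unitaryGroup (Bits n) ℂ := by
  refine list_prod_mem fun x hx => ?_
  obtain ⟨j, -, rfl⟩ := List.mem_map.1 hx
  exact gate_mem_unitaryGroup (hH ℓ j) _

lemma actsTriviallyAt_rotationsIn {q : Fin n} (h : ∀ j ∈ J, ActsTriviallyAt (c.gen ℓ j) q)
    (θ : c.Idx → ℝ) : ActsTriviallyAt (c.rotationsIn ℓ J θ) q := by
  refine ActsTriviallyAt.list_prod fun x hx => ?_
  obtain ⟨j, hj, rfl⟩ := List.mem_map.1 hx
  exact (h j (by simpa using (List.mem_filter.1 hj).2)).gate _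

lemma mem_supp_or_exists_of_mem_supp_rotationsIn_conj {A : Op n} {θ : c.Idx → ℝ} {p : Fin n}
    (hp : p ∈ supp ((c.rotationsIn ℓ J θ)ᴴ * A * c.rotationsIn ℓ J θ)) :
    p ∈ supp A ∨ ∃ j ∈ J, p ∈ supp (c.gen ℓ j) := by
  by_contra! hcon
  have hrot := actsTriviallyAt_rotationsIn (fun j hj => notMem_supp.1 (hcon.2 j hj)) θ
  exact mem_supp.1 hp ((hrot.conjTranspose.mul (notMem_supp.1 hcon.1)).mul hrot)

end Rotations

namespace IsInteractionGraph

variable (hG : c.IsInteractionGraph G r) (ℓ : Fin c.depth)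

/-- A choice of the blocks of qubits assigned to the rotations of layer `ℓ`. -/
def block : Fin (c.gates ℓ) → Finset (Fin n) := (hG.rotations ℓ).choose

lemma supp_gen_subset_block (j : Fin (c.gates ℓ)) : supp (c.gen ℓ j) ⊆ hG.block ℓ j :=
  (hG.rotations ℓ).choose_spec.1 j

lemma edist_lt_of_mem_block {j : Fin (c.gates ℓ)} {p q : Fin n} (hp : p ∈ hG.block ℓ j)
    (hq : q ∈ hG.block ℓ j) : G.edist p q < r :=
  (hG.rotations ℓ).choose_spec.2.1 j p hp q hq

lemma commute_gen_of_block_ne {i j : Fin (c.gates ℓ)} (h : hG.block ℓ i ≠ hG.block ℓ j) :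
    Commute (c.gen ℓ i) (c.gen ℓ j) :=
  (hG.rotations ℓ).choose_spec.2.2 i j h

/-- The rotations of layer `ℓ` whose block meets `S`. -/
def rotationsMeeting (S : Set (Fin n)) : Set (Fin (c.gates ℓ)) :=
  {j | ∃ q ∈ hG.block ℓ j, q ∈ S}

lemma layer_eq_mul_rotationsIn (S : Set (Fin n)) (θ : c.Idx → ℝ) :
    c.layer θ ℓ = (c.ent ℓ : Op n) * (c.rotationsIn ℓ (hG.rotationsMeeting ℓ S)ᶜ θ *
      c.rotationsIn ℓ (hG.rotationsMeeting ℓ S) θ) := by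
  classical
  rw [layer_eq, List.ofFn_eq_map,
    prod_map_eq_filter_mul_filter _ (fun j => j ∈ hG.rotationsMeeting ℓ S)]
  · simp only [rotationsIn, Set.mem_compl_iff]
  · intro i j ⟨q, hq, hqS⟩ hj
    refine commute_gate (hG.commute_gen_of_block_ne ℓ fun hij => hj ⟨q, ?_, hqS⟩) _ _
    rwa [← hij]

lemma layer_conj (hH : ∀ ℓ j, (c.gen ℓ j).IsHermitian) {A : Op n} {S : Set (Fin n)}
    (hA : ∀ p ∈ supp ((c.ent ℓ : Op n)ᴴ * A * (c.ent ℓ : Op n)), p ∈ S) (θ : c.Idx → ℝ) :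
    (c.layer θ ℓ)ᴴ * A * c.layer θ ℓ =
      (c.rotationsIn ℓ (hG.rotationsMeeting ℓ S) θ)ᴴ *
        ((c.ent ℓ : Op n)ᴴ * A * (c.ent ℓ : Op n)) *
        c.rotationsIn ℓ (hG.rotationsMeeting ℓ S) θ := by
  set J := hG.rotationsMeeting ℓ S
  have hcomm : Commute (c.rotationsIn ℓ Jᶜ θ) ((c.ent ℓ : Op n)ᴴ * A * (c.ent ℓ : Op n)) := by
    refine commute_of_disjoint_supp (Finset.disjoint_right.2 fun q hq => notMem_supp.2 ?_)
    refine actsTriviallyAt_rotationsIn (fun j hj => notMem_supp.1 fun hqj => ?_) θ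
    exact hj ⟨q, hG.supp_gen_subset_block ℓ j hqj, hA q hq⟩
  calc (c.layer θ ℓ)ᴴ * A * c.layer θ ℓ
      = (c.rotationsIn ℓ J θ)ᴴ * ((c.rotationsIn ℓ Jᶜ θ)ᴴ *
          ((c.ent ℓ : Op n)ᴴ * A * (c.ent ℓ : Op n)) * c.rotationsIn ℓ Jᶜ θ) *
          c.rotationsIn ℓ J θ := by
        rw [hG.layer_eq_mul_rotationsIn ℓ S]
        simp only [Matrix.conjTranspose_mul, mul_assoc, J]
    _ = _ := by rw [conj_eq_self_of_commute (rotationsIn_mem_unitaryGroup hH θ) hcomm]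

include hG in
lemma exists_edist_le_one_of_mem_supp_ent_conj {A : Op n} {p : Fin n}
    (hp : p ∈ supp ((c.ent ℓ : Op n)ᴴ * A * (c.ent ℓ : Op n))) :
    ∃ q ∈ supp A, G.edist q p ≤ 1 := by
  obtain ⟨q, hq, hqp⟩ := exists_mem_supp_of_mem_supp_conj (c.ent ℓ).2 (hG.entangler ℓ) A hp
  refine ⟨q, hq, ?_⟩
  rcases hqp with rfl | hadj
  · simp
  · exact (SimpleGraph.edist_eq_one_iff_adj.2 hadj).le

include hG in
lemma exists_edist_le_of_mem_supp_layer_conj (hH : ∀ ℓ j, (c.gen ℓ j).IsHermitian) {A : Op n}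
    {θ : c.Idx → ℝ} {p : Fin n} (hp : p ∈ supp ((c.layer θ ℓ)ᴴ * A * c.layer θ ℓ)) :
    ∃ q ∈ supp A, G.edist q p ≤ (max r 1 : ℕ) := by
  rw [hG.layer_conj ℓ hH fun _ => Finset.mem_coe.2] at hp
  rcases mem_supp_or_exists_of_mem_supp_rotationsIn_conj hp with hp | ⟨j, ⟨q', hq', hq'S⟩, hpj⟩
  · obtain ⟨q, hq, hqp⟩ := hG.exists_edist_le_one_of_mem_supp_ent_conj ℓ hp
    exact ⟨q, hq, hqp.trans (by exact_mod_cast le_max_right r 1)⟩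
  · obtain ⟨q, hq, hqq'⟩ := hG.exists_edist_le_one_of_mem_supp_ent_conj ℓ hq'S
    have hlt := hG.edist_lt_of_mem_block ℓ hq' (hG.supp_gen_subset_block ℓ j hpj)
    refine ⟨q, hq, ?_⟩
    calc G.edist q p ≤ 1 + G.edist q' p := SimpleGraph.edist_triangle.trans (by gcongr)
      _ = G.edist q' p + 1 := add_comm _ _
      _ ≤ r := Order.add_one_le_of_lt hlt
      _ ≤ (max r 1 : ℕ) := by exact_mod_cast le_max_left r 1

end IsInteractionGraph

/-- The observable `O` in the Heisenberg picture after the first `m` layers. -/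
def heisenberg (c : Circuit n) (O : Op n) (m : ℕ) (θ : c.Idx → ℝ) : Op n :=
  ((List.ofFn (c.layer θ)).take m).prodᴴ * O * ((List.ofFn (c.layer θ)).take m).prod

lemma heisenberg_zero (O : Op n) (θ : c.Idx → ℝ) : c.heisenberg O 0 θ = O := by
  simp [heisenberg]

lemma heisenberg_succ (O : Op n) (ℓ : Fin c.depth) (θ : c.Idx → ℝ) :
    c.heisenberg O (ℓ + 1) θ = (c.layer θ ℓ)ᴴ * c.heisenberg O ℓ θ * c.layer θ ℓ := by
  rw [heisenberg, heisenberg, List.prod_take_succ _ _ (by simp)]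
  simp only [Matrix.conjTranspose_mul, mul_assoc, List.getElem_ofFn]

lemma cost_eq_heisenberg (O : Op n) (θ : c.Idx → ℝ) :
    c.cost O θ = (c.heisenberg O c.depth θ 0 0).re := by
  rw [cost, state, Matrix.star_mulVec, Matrix.mulVec_mulVec, ← Matrix.dotProduct_mulVec,
    Matrix.mulVec_mulVec, ← Pi.single_star, star_one, Matrix.mulVec_single_one,
    single_one_dotProduct, Matrix.col_apply, heisenberg, List.take_of_length_le (by simp),
    ← unitary, mul_assoc]

namespace IsInteractionGraph

variable (hG : c.IsInteractionGraph G r)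

/-- The parameters in the backward light cone of a set `S` of qubits: a layer enlarges the support
of an observable by at most `max r 1`, of which the entangler contributes `1`. The maximum matters
for `r = 0` only, where all blocks are empty but the entanglers still spread supports. -/
def lightCone (S : Finset (Fin n)) : Set c.Idx :=
  {a | ∃ p ∈ S, ∃ q ∈ hG.block a.1 a.2, G.edist p q ≤ (max r 1 * a.1 + 1 : ℕ)}

include hG in
lemma exists_edist_le_of_mem_supp_heisenberg (hH : ∀ ℓ j, (c.gen ℓ j).IsHermitian) {O : Op n}
    {m : ℕ} (hm : m ≤ c.depth) {θ : c.Idx → ℝ} {p : Fin n} (hp : p ∈ supp (c.heisenberg O m θ)) :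
    ∃ q ∈ supp O, G.edist q p ≤ (max r 1 * m : ℕ) := by
  induction m generalizing p with
  | zero => exact ⟨p, by rwa [heisenberg_zero] at hp, by simp⟩
  | succ m ih =>
    rw [heisenberg_succ O ⟨m, hm⟩] at hp
    obtain ⟨q', hq', hq'p⟩ := hG.exists_edist_le_of_mem_supp_layer_conj ⟨m, hm⟩ hH hp
    obtain ⟨q, hq, hqq'⟩ := ih (Nat.le_of_succ_le hm) hq'
    refine ⟨q, hq, (SimpleGraph.edist_triangle.trans (add_le_add hqq' hq'p)).trans ?_⟩
    rw [mul_add_one, Nat.cast_add]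

lemma dependsOn_heisenberg (hH : ∀ ℓ j, (c.gen ℓ j).IsHermitian) (O : Op n) {m : ℕ}
    (hm : m ≤ c.depth) : DependsOn (c.heisenberg O m) (hG.lightCone (supp O)) := by
  induction m with
  | zero => intro θ θ' _; rw [heisenberg_zero, heisenberg_zero]
  | succ m ih =>
    let ℓ : Fin c.depth := ⟨m, hm⟩
    let S : Set (Fin n) := {p | ∃ q ∈ supp O, G.edist q p ≤ (max r 1 * m + 1 : ℕ)}
    have hS : ∀ θ, ∀ p ∈ supp ((c.ent ℓ : Op n)ᴴ * c.heisenberg O m θ * (c.ent ℓ : Op n)),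
        p ∈ S := fun θ p hp => by
      obtain ⟨q', hq', hq'p⟩ := hG.exists_edist_le_one_of_mem_supp_ent_conj ℓ hp
      obtain ⟨q, hq, hqq'⟩ :=
        hG.exists_edist_le_of_mem_supp_heisenberg hH (Nat.le_of_succ_le hm) hq'
      refine ⟨q, hq, (SimpleGraph.edist_triangle.trans (add_le_add hqq' hq'p)).trans ?_⟩
      rw [Nat.cast_add, Nat.cast_one]
    intro θ θ' h
    rw [heisenberg_succ O ℓ θ, heisenberg_succ O ℓ θ', hG.layer_conj ℓ hH (hS θ),
      hG.layer_conj ℓ hH (hS θ'), ih (Nat.le_of_succ_le hm) h, rotationsIn_congr]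
    rintro j ⟨q', hq', q, hq, hqq'⟩
    exact h ⟨ℓ, j⟩ ⟨q, hq, q', hq', hqq'⟩

lemma dependsOn_cost (hH : ∀ ℓ j, (c.gen ℓ j).IsHermitian) (O : Op n) :
    DependsOn (c.cost O) (hG.lightCone (supp O)) := fun θ θ' h => by
  rw [cost_eq_heisenberg, cost_eq_heisenberg, hG.dependsOn_heisenberg hH O le_rfl h]

lemma disjoint_lightCone {S T : Finset (Fin n)}
    (hfar : ∀ p ∈ S, ∀ q ∈ T, ¬ G.edist p q ≤ (2 * r * c.depth : ℕ)) :
    Disjoint (hG.lightCone S) (hG.lightCone T) := by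
  rw [Set.disjoint_left]
  rintro ⟨ℓ, j⟩ ⟨p, hp, p', hp', hpp'⟩ ⟨q, hq, q', hq', hqq'⟩
  have hlt : G.edist p' q' < r := hG.edist_lt_of_mem_block ℓ hp' hq'
  have hr : 1 ≤ r := by exact_mod_cast Order.one_le_iff_pos.2 (pos_of_gt hlt)
  rw [max_eq_left hr] at hpp' hqq'
  rw [SimpleGraph.edist_comm] at hqq'
  refine hfar p hp q hq ?_
  have hdepth : r * ℓ + 1 + (r + (r * ℓ)) ≤ 2 * r * c.depth := by
    nlinarith [Nat.mul_le_mul_left r (Nat.succ_le_of_lt ℓ.2)]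
  calc G.edist p q
      ≤ G.edist p p' + (G.edist p' q' + G.edist q' q) :=
        SimpleGraph.edist_triangle.trans (add_le_add_right SimpleGraph.edist_triangle _)
    _ ≤ (r * ℓ + 1 : ℕ) + (G.edist p' q' + (r * ℓ + 1 : ℕ)) := by gcongr
    _ = (r * ℓ + 1 : ℕ) + ((G.edist p' q' + 1) + (r * ℓ : ℕ)) := by push_cast; ring
    _ ≤ (r * ℓ + 1 : ℕ) + (r + (r * ℓ : ℕ)) := by
        gcongr; exact Order.add_one_le_of_lt hlt
    _ ≤ (2 * r * c.depth : ℕ) := by exact_mod_cast hdepth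

include hG in
lemma covariance_cost_eq_zero (hH : ∀ ℓ j, (c.gen ℓ j).IsHermitian) {A B : Op n}
    (hfar : ∀ p ∈ supp A, ∀ q ∈ supp B, ¬ G.edist p q ≤ (2 * r * c.depth : ℕ)) :
    cov[c.cost A, c.cost B; uniformAngles c.Idx] = 0 :=
  (indepFun_of_dependsOn (continuous_cost A).measurable (continuous_cost B).measurable
    (hG.disjoint_lightCone hfar) (hG.dependsOn_cost hH A) (hG.dependsOn_cost hH B)
    ).covariance_eq_zero (memLp_cost hH A) (memLp_cost hH B)

end IsInteractionGraph

end Circuit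

/-! ### Variance of local costs -/

lemma variance_sum_le_of_covariance_eq_zero {Ω κ : Type*} [MeasurableSpace Ω] {μ : Measure Ω}
    [IsFiniteMeasure μ] [Fintype κ] {X : κ → Ω → ℝ} {s : ℝ} {N : ℕ} {near : κ → Finset κ}
    (hX : ∀ v, MemLp (X v) 2 μ) (hvar : ∀ v, Var[X v; μ] ≤ s) (hcard : ∀ v, (near v).card ≤ N)
    (hcov : ∀ v w, w ∉ near v → cov[X v, X w; μ] = 0) :
    Var[fun ω => ∑ v, X v ω; μ] ≤ Fintype.card κ * (N * s) := by
  have hcov_le : ∀ v w, cov[X v, X w; μ] ≤ s := fun v w =>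
    (covariance_le_half_variance_add (hX v) (hX w)).trans (by linarith [hvar v, hvar w])
  have hrow : ∀ v, ∑ w, cov[X v, X w; μ] ≤ N * s := fun v => by
    have hs : 0 ≤ s := (variance_nonneg (X v) μ).trans (hvar v)
    calc ∑ w, cov[X v, X w; μ]
        = ∑ w ∈ near v, cov[X v, X w; μ] :=
          (Finset.sum_subset (Finset.subset_univ _) fun w _ hw => hcov v w hw).symm
      _ ≤ (near v).card * s := by
          simpa using Finset.sum_le_card_nsmul (near v) _ s fun w _ => hcov_le v w
      _ ≤ N * s := by gcongr; exact hcard v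
  rw [variance_fun_sum hX]
  simpa using Finset.sum_le_card_nsmul Finset.univ _ (N * s) fun v _ => hrow v

section

variable {n : ℕ} (G : SimpleGraph (Fin n))

lemma mem_ball {G : SimpleGraph (Fin n)} {v w : Fin n} {m : ℕ} :
    w ∈ ball G v m ↔ G.edist v w ≤ m := by
  simp [ball]

lemma card_ball_le_growth (v : Fin n) (m : ℕ) : (ball G v m).card ≤ growth G m :=
  Finset.le_sup (f := fun v => (ball G v m).card) (Finset.mem_univ v)

open Classical in
/-- The indices of the sets of the family `S` that contain a vertex at distance at most `m` from
`S v`. -/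
def nearIndices (S : Fin n → Finset (Fin n)) (m : ℕ) (v : Fin n) : Finset (Fin n) :=
  Finset.univ.filter fun w => ∃ p ∈ S v, ∃ q ∈ S w, G.edist p q ≤ m

lemma card_nearIndices_le {S : Fin n → Finset (Fin n)} {k d : ℕ} (hcard : ∀ v, (S v).card ≤ k)
    (hball : ∀ v, S v ⊆ ball G v d) (m : ℕ) (v : Fin n) :
    (nearIndices G S m v).card ≤ k * growth G (d + m) := by
  have hsub : nearIndices G S m v ⊆ (S v).biUnion fun p => ball G p (d + m) := fun w hw => by
    obtain ⟨p, hp, q, hq, hpq⟩ := (Finset.mem_filter.1 hw).2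
    have hqw : G.edist q w ≤ d := SimpleGraph.edist_comm.trans_le (mem_ball.1 (hball w hq))
    refine Finset.mem_biUnion.2 ⟨p, hp, mem_ball.2 ?_⟩
    exact (SimpleGraph.edist_triangle.trans (add_le_add hpq hqw)).trans_eq
      (by rw [add_comm d m, Nat.cast_add])
  exact (Finset.card_le_card hsub).trans <|
    (Finset.card_biUnion_le_card_mul _ _ _ fun p _ => card_ball_le_growth G p _).trans <|
      Nat.mul_le_mul_right _ (hcard v)

end

namespace Circuit

variable {n : ℕ} {c : Circuit n} {G : SimpleGraph (Fin n)} {r k d : ℕ}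

lemma variance_averagedCost_le (hn : 0 < n) (hG : c.IsInteractionGraph G r)
    (hH : ∀ ℓ j, (c.gen ℓ j).IsHermitian) {O : Fin n → Op n} (hO : ∀ v, opNorm (O v) ≤ 1)
    (hcard : ∀ v, (supp (O v)).card ≤ k) (hball : ∀ v, supp (O v) ⊆ ball G v d) :
    Var[c.averagedCost O; uniformAngles c.Idx] ≤
      k * (growth G (d + 2 * r * c.depth) / n : ℝ) := by
  have hvar : ∀ v, Var[c.cost (O v); uniformAngles c.Idx] ≤ 1 := fun v =>
    (variance_cost_le hH (O v)).trans (pow_le_one₀ (norm_nonneg _) (hO v))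
  have hsum := variance_sum_le_of_covariance_eq_zero (fun v => memLp_cost hH (O v)) hvar
    (card_nearIndices_le G hcard hball (2 * r * c.depth)) fun v w hw =>
      hG.covariance_cost_eq_zero hH fun p hp q hq hpq =>
        hw (Finset.mem_filter.2 ⟨Finset.mem_univ w, p, hp, q, hq, hpq⟩)
  calc Var[c.averagedCost O; uniformAngles c.Idx]
      = (1 / n : ℝ) ^ 2 * Var[fun θ => ∑ v, c.cost (O v) θ; uniformAngles c.Idx] :=
        variance_const_mul _ _ _
    _ ≤ (1 / n : ℝ) ^ 2 * (n * ((k * growth G (d + 2 * r * c.depth) : ℕ) * 1)) := by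
        gcongr
        simpa only [Fintype.card_fin] using hsum
    _ = k * (growth G (d + 2 * r * c.depth) / n : ℝ) := by
        push_cast
        field_simp

end Circuit

end PQC

end

open PQC ProbabilityTheory in
theorem theorem3p3_general {n : ℕ} {c : Circuit n} (hH : ∀ ℓ j, (c.gen ℓ j).IsHermitian)
    (hsq : ∀ ℓ j, c.gen ℓ j * c.gen ℓ j = (1 / 4 : ℂ) • (1 : Op n)) (a b : c.Idx) :
    (∀ O : Op n, Var[hessianEntry (c.cost O) a b; c.initLaw] ≤ Var[c.cost O; c.initLaw]) ∧
    ∀ {k r : ℕ} {G : SimpleGraph (Fin n)} {O : Fin n → Op n}, 0 < n → c.IsInteractionGraph G r →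
      (∀ v, opNorm (O v) ≤ 1) → (∀ v, (supp (O v)).card ≤ k) → (∀ v, supp (O v) ⊆ ball G v k) →
      Var[hessianEntry (c.averagedCost O) a b; c.initLaw] ≤
        k * (growth G (k + 2 * r * c.depth) / n : ℝ) ∧
      ∀ {D K : ℝ}, (∀ m : ℕ, 1 ≤ m → (growth G m : ℝ) ≤ K * (m : ℝ) ^ D) →
        Var[hessianEntry (c.averagedCost O) a b; c.initLaw] ≤
          k * K * (((k + 2 * r * c.depth : ℕ) : ℝ) ^ D / n) := by
  have hHessian (O : Op n) :
      Var[hessianEntry (c.cost O) a b; c.initLaw] ≤ Var[c.cost O; c.initLaw] :=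
    (Circuit.isTrigCost_cost hH hsq O).variance_hessianEntry_le a b
  refine ⟨hHessian, fun {k r G O} hn hG hO hcard hball => ?_⟩
  have hlocal : Var[hessianEntry (c.averagedCost O) a b; c.initLaw] ≤
      k * (growth G (k + 2 * r * c.depth) / n : ℝ) := by
    refine le_trans ?_ (Circuit.variance_averagedCost_le hn hG hH hO hcard hball)
    rw [Circuit.averagedCost_eq_cost]
    exact hHessian _
  refine ⟨hlocal, fun {D K} hgrowth => hlocal.trans ?_⟩
  rcases Nat.eq_zero_or_pos k with rfl | hk
  · simp
  · calc (k : ℝ) * (growth G (k + 2 * r * c.depth) / n)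
        ≤ k * (K * ((k + 2 * r * c.depth : ℕ) : ℝ) ^ D / n) := by
          gcongr
          exact hgrowth _ (by omega)
      _ = k * K * (((k + 2 * r * c.depth : ℕ) : ℝ) ^ D / n) := by ring

theorem theorem3p3 :
    -- (i) global objectives
    (∀ cg α : ℕ → ℕ → ℝ, (∀ r L, 0 < cg r L) → (∀ r L, 0 < α r L) →
      ∃ c' α' : ℕ → ℕ → ℝ, (∀ r L, 0 < c' r L) ∧ (∀ r L, 0 < α' r L) ∧
        ∀ (r : ℕ) (n : ℕ → ℕ) (c : (i : ℕ) → PQC.Circuit (n i)) (O : (i : ℕ) → PQC.Op (n i)),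
          PQC.IsAdmissibleFamily r n c →
          (∀ i, PQC.IsNormalizedObservable (O i)) →
          PQC.IsGlobalFamily n O →
          (∀ i, ProbabilityTheory.variance ((c i).cost (O i)) (c i).initLaw ≤
            cg r (c i).depth * Real.exp (-(α r (c i).depth * (n i : ℝ)))) →
          ∀ (i : ℕ) (a b : (c i).Idx),
            ProbabilityTheory.variance (PQC.hessianEntry ((c i).cost (O i)) a b) (c i).initLaw ≤
              c' r (c i).depth * Real.exp (-(α' r (c i).depth * (n i : ℝ)))) ∧
    -- (ii) local objectives
    (∃ cloc : ℕ → ℕ → ℕ → ℝ, (∀ k r L, 0 < cloc k r L) ∧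
      ∀ (k r : ℕ) (n : ℕ → ℕ) (c : (i : ℕ) → PQC.Circuit (n i))
        (G : (i : ℕ) → SimpleGraph (Fin (n i))) (O : (i : ℕ) → Fin (n i) → PQC.Op (n i)),
          PQC.IsAdmissibleFamily r n c →
          (∀ i, (c i).IsInteractionGraph (G i) r) →
          (∀ i, PQC.IsLocalTerms (G i) k (O i)) →
          ∀ (i : ℕ) (a b : (c i).Idx),
            ProbabilityTheory.variance (PQC.hessianEntry ((c i).averagedCost (O i)) a b)
                (c i).initLaw ≤
              cloc k r (c i).depth *
                ((PQC.growth (G i) (k + 2 * r * (c i).depth) : ℝ) / (n i : ℝ))) ∧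
    -- (ii) local objectives, polynomial growth: `V_G(m) = O(m^D)` uniformly in the family
    (∀ D K : ℝ, 0 < K →
      ∃ cloc : ℕ → ℕ → ℕ → ℝ, (∀ k r L, 0 < cloc k r L) ∧
      ∀ (k r : ℕ) (n : ℕ → ℕ) (c : (i : ℕ) → PQC.Circuit (n i))
        (G : (i : ℕ) → SimpleGraph (Fin (n i))) (O : (i : ℕ) → Fin (n i) → PQC.Op (n i)),
          PQC.IsAdmissibleFamily r n c →
          (∀ i, (c i).IsInteractionGraph (G i) r) →
          (∀ i, PQC.IsLocalTerms (G i) k (O i)) →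
          (∀ (i m : ℕ), 1 ≤ m → (PQC.growth (G i) m : ℝ) ≤ K * (m : ℝ) ^ D) →
          ∀ (i : ℕ) (a b : (c i).Idx),
            ProbabilityTheory.variance (PQC.hessianEntry ((c i).averagedCost (O i)) a b)
                (c i).initLaw ≤
              cloc k r (c i).depth *
                (((k + 2 * r * (c i).depth : ℕ) : ℝ) ^ D / (n i : ℝ))) := by
  refine ⟨fun cg α hcg hα => ⟨cg, α, hcg, hα, fun r n c O hfam _ _ hvar i a b => ?_⟩,
    ⟨fun k _ _ => k + 1, fun k _ _ => by positivity, fun k r n c G O hfam hG hO i a b => ?_⟩,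
    fun D K hK => ⟨fun k _ _ => (k + 1) * K, fun k _ _ => by positivity,
      fun k r n c G O hfam hG hO hgrowth i a b => ?_⟩⟩
  all_goals
    obtain ⟨hglobal, hlocal⟩ := theorem3p3_general (c := c i)
      (fun ℓ j => (hfam.generators i ℓ j).1) (fun ℓ j => (hfam.generators i ℓ j).2.2) a b
  · exact (hglobal (O i)).trans (hvar i)
  all_goals
    obtain ⟨hvar, hvar_poly⟩ := hlocal (hfam.pos i) (hG i) (fun v => ((hO i).normalized v).norm_le)
      (hO i).card_le (hO i).near
  · exact hvar.trans (by gcongr; simp)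
  · exact (hvar_poly (hgrowth i)).trans (by gcongr; linarith)
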